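/- Let $\mathbb T=\mathbb R/2\pi\mathbb Z$ carry normalized Haar measure, $L^1=L^1(\mathbb T;\mathbb C)$. For a complex Banach space $X$ let $\widetilde H^1(X)$ be the closure in the Bochner space $L^1(\mathbb T;X)$ of the analytic polynomials $\sum_{k=0}^n e^{ik\theta}x_k$ ($n\in\mathbb N$, $x_k\in X$), and let $H^1=\widetilde H^1(\mathbb C)\subset L^1$. Let $H^1\hat\otimes X$ be the projective tensor product, i.e. the completion of the algebraic tensor product $H^1\otimes X$ for the norm $\|u\|_\wedge=\inf\{\sum_k\|h_k\|\,\|x_k\| : u=\sum_k h_k\otimes x_k\}$ (finite sums). The space $X$ is called $H^1$-projective if the canonical map $H^1\hat\otimes X\to\widetilde H^1(X)$, $h\otimes x\mapsto h(\cdot)x$, is surjective; in that case $\eta(X)$ denotes the smallest constant $c\ge 0$ such that $\|F\|_{H^1\hat\otimes X}\le c\,\|F\|_{\widetilde H^1(X)}$ for all $F\in H^1\hat\otimes X$. For a complex Banach space $Y$, let $\mathcal L_F(H^1,Y)$ be the set of bounded operators $v:H^1\to Y$ for which there is a positive integer $k_v$ with $v(e^{in\cdot})=0$ for all $n>k_v$,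 and let $\mathcal L_F(L^1,Y)$ be the set of bounded operators $w:L^1\to Y$ for which there is a positive integer $k_w$ with $w(e^{in\cdot})=0$ for all integers $n\notin[-k_w,k_w]$. **Proposition 2.3.** For every complex Banach space $X$ the following assertions are equivalent: (i) $X$ is $H^1$-projective. (ii) There exists $\lambda>0$ such that every $v\in\mathcal L(H^1,X^*)$ has an extension $\bar v\in\mathcal L(L^1,X^*)$, i.e. $\bar v|_{H^1}=v$, with $\|\bar v\|\le\lambda\|v\|$. (iii) There exists $\lambda>0$ such that every $v\in\mathcal L_F(H^1,X^*)$ has an extension $\bar v\in\mathcal L_F(L^1,X^*)$ with $\|\bar v\|\le\lambda\|v\|$. Moreover, if $X$ is $H^1$-projective, then the infimum of the constants $\lambda>0$ admissible in (ii) and the infimum of the constants $\lambda>0$ admissible in (iii) are both equal to $\eta(X)$; in (ii) the constant $\eta(X)$ is itself attained: every $v\in\mathcal L(H^1,X^*)$ has an extension $\bar v\in\mathcal L(L^1,X^*)$ with $\|\bar v\|\le\eta(X)\|v\|$. -/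

import Mathlib

set_option linter.unusedSectionVars false

open MeasureTheory Set
open scoped TensorProduct

namespace HOneProj

noncomputable section

/-! ### The projective tensor product -/

section ProjectiveTensor

variable (E F : Type*) [NormedAddCommGroup E] [NormedSpace ℂ E]
  [NormedAddCommGroup F] [NormedSpace ℂ F]

/-- The algebraic tensor product over `ℂ`, as a type of its own that carries
the projective tensor norm. -/
def AlgTensor : Type _ := E ⊗[ℂ] F

instance : AddCommGroup (AlgTensor E F) := inferInstanceAs (AddCommGroup (E ⊗[ℂ] F))

instance : Module ℂ (AlgTensor E F) := inferInstanceAs (Module ℂ (E ⊗[ℂ] F))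

variable {E F}

/-- The elementary tensor `x ⊗ y`. -/
def tmul (x : E) (y : F) : AlgTensor E F := x ⊗ₜ[ℂ] y

/-- The tensor `∑ xₖ ⊗ yₖ` represented by a finite list of pairs `(xₖ, yₖ)`. -/
def repTensor (l : List (E × F)) : AlgTensor E F := (l.map fun p => tmul p.1 p.2).sum

/-- The cost `∑ ‖xₖ‖ ‖yₖ‖` of a finite list of pairs `(xₖ, yₖ)`. -/
def repCost (l : List (E × F)) : ℝ := (l.map fun p => ‖p.1‖ * ‖p.2‖).sum

/-- The projective tensor norm: the infimum of `∑ ‖xₖ‖ ‖yₖ‖` over all finite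
representations `u = ∑ xₖ ⊗ yₖ`. -/
def projNorm (u : AlgTensor E F) : ℝ :=
  sInf (repCost '' {l : List (E × F) | repTensor l = u})

lemma repCost_nonneg (l : List (E × F)) : 0 ≤ repCost l := by
  refine List.sum_nonneg fun a ha => ?_
  obtain ⟨p, -, rfl⟩ := List.mem_map.1 ha
  positivity

lemma repTensor_append (l m : List (E × F)) :
    repTensor (l ++ m) = repTensor l + repTensor m := by
  simp [repTensor]

lemma repCost_append (l m : List (E × F)) :
    repCost (l ++ m) = repCost l + repCost m := by
  simp [repCost]

lemma repTensor_smul (a : ℂ) (l : List (E × F)) :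
    repTensor (l.map fun p => (a • p.1, p.2)) = a • repTensor l := by
  induction l with
  | nil => simp [repTensor]
  | cons p l ih =>
    simp only [repTensor, List.map_cons, List.sum_cons, smul_add] at ih ⊢
    rw [ih]
    rfl

lemma repCost_smul (a : ℂ) (l : List (E × F)) :
    repCost (l.map fun p => (a • p.1, p.2)) = ‖a‖ * repCost l := by
  simp [repCost, Function.comp_def, norm_smul, mul_assoc, List.sum_map_mul_left]

lemma exists_repTensor (u : AlgTensor E F) : ∃ l : List (E × F), repTensor l = u := by
  refine TensorProduct.induction_on
    (motive := fun u => ∃ l : List (E × F), repTensor l = u) u ?_ ?_ ?_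
  · exact ⟨[], rfl⟩
  · intro x y
    exact ⟨[(x, y)], by simp [repTensor]; rfl⟩
  · rintro _ _ ⟨l, rfl⟩ ⟨m, rfl⟩
    exact ⟨l ++ m, repTensor_append l m⟩

lemma projNorm_le (l : List (E × F)) : projNorm (repTensor l) ≤ repCost l :=
  csInf_le ⟨0, by rintro _ ⟨m, -, rfl⟩; exact repCost_nonneg m⟩ ⟨l, rfl, rfl⟩

lemma le_projNorm {u : AlgTensor E F} {c : ℝ}
    (h : ∀ l : List (E × F), repTensor l = u → c ≤ repCost l) : c ≤ projNorm u := by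
  obtain ⟨l, hl⟩ := exists_repTensor u
  refine le_csInf ⟨_, l, hl, rfl⟩ ?_
  rintro _ ⟨m, hm, rfl⟩
  exact h m hm

lemma projNorm_nonneg (u : AlgTensor E F) : 0 ≤ projNorm u :=
  le_projNorm fun l _ => repCost_nonneg l

lemma projNorm_add_le (u v : AlgTensor E F) : projNorm (u + v) ≤ projNorm u + projNorm v := by
  rw [← sub_le_iff_le_add]
  refine le_projNorm fun l hl => ?_
  rw [sub_le_comm]
  refine le_projNorm fun m hm => ?_
  rw [sub_le_iff_le_add', ← repCost_append, ← hl, ← hm, ← repTensor_append]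
  exact projNorm_le _

lemma projNorm_smul_le (a : ℂ) (u : AlgTensor E F) : projNorm (a • u) ≤ ‖a‖ * projNorm u := by
  rcases eq_or_ne a 0 with rfl | ha
  · have h := projNorm_le ([] : List (E × F))
    simp only [repTensor, repCost, List.map_nil, List.sum_nil] at h
    simpa using h
  · have ha' : 0 < ‖a‖ := norm_pos_iff.2 ha
    rw [← div_le_iff₀' ha']
    refine le_projNorm fun l hl => ?_
    rw [div_le_iff₀' ha', ← repCost_smul, ← hl, ← repTensor_smul]
    exact projNorm_le _

lemma projNorm_smul (a : ℂ) (u : AlgTensor E F) : projNorm (a • u) = ‖a‖ * projNorm u := by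
  refine le_antisymm (projNorm_smul_le a u) ?_
  rcases eq_or_ne a 0 with rfl | ha
  · simpa using projNorm_nonneg _
  · have ha' : 0 < ‖a‖ := norm_pos_iff.2 ha
    have h := projNorm_smul_le a⁻¹ (a • u)
    rwa [smul_smul, inv_mul_cancel₀ ha, one_smul, norm_inv, ← div_eq_inv_mul,
      le_div_iff₀' ha'] at h

instance : Norm (AlgTensor E F) := ⟨projNorm⟩

lemma algTensor_core : SeminormedSpace.Core ℂ (AlgTensor E F) where
  norm_nonneg := projNorm_nonneg
  norm_smul := projNorm_smul
  norm_triangle := projNorm_add_le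

instance : SeminormedAddCommGroup (AlgTensor E F) :=
  SeminormedAddCommGroup.ofCore algTensor_core

instance : NormedSpace ℂ (AlgTensor E F) where
  norm_smul_le a u := projNorm_smul_le a u

variable (E F) in
/-- The projective tensor product: the completion of the algebraic tensor product for
the projective tensor norm. -/
abbrev ProjTensor : Type _ := UniformSpace.Completion (AlgTensor E F)

variable {G : Type*} [NormedAddCommGroup G] [NormedSpace ℂ G]

/-- The linear map on the algebraic tensor product induced by a bounded bilinear map. -/
def algLift (B : E →L[ℂ] F →L[ℂ] G) : AlgTensor E F →ₗ[ℂ] G :=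
  TensorProduct.lift (ContinuousLinearMap.toLinearMap₁₂ B)

lemma algLift_tmul (B : E →L[ℂ] F →L[ℂ] G) (x : E) (y : F) :
    algLift B (tmul x y) = B x y := by
  exact TensorProduct.lift.tmul _ _

lemma norm_algLift_le (B : E →L[ℂ] F →L[ℂ] G) (u : AlgTensor E F) :
    ‖algLift B u‖ ≤ ‖B‖ * ‖u‖ := by
  have key : ∀ l : List (E × F), ‖algLift B (repTensor l)‖ ≤ ‖B‖ * repCost l := by
    intro l
    induction l with
    | nil => simp [repTensor, repCost]
    | cons p l ih =>
      have h1 : repTensor (p :: l) = tmul p.1 p.2 + repTensor l := by simp [repTensor]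
      have h2 : repCost (p :: l) = ‖p.1‖ * ‖p.2‖ + repCost l := by simp [repCost]
      rw [h1, h2, map_add, algLift_tmul, mul_add, ← mul_assoc]
      exact (norm_add_le _ _).trans (add_le_add (B.le_opNorm₂ _ _) ih)
  change _ ≤ ‖B‖ * projNorm u
  rcases eq_or_lt_of_le (norm_nonneg B) with h0 | h0
  · obtain ⟨l, rfl⟩ := exists_repTensor u
    simpa [← h0] using key l
  · rw [← div_le_iff₀' h0]
    refine le_projNorm fun l hl => ?_
    rw [div_le_iff₀' h0, ← hl]
    exact key l

/-- The bounded linear map on the projective tensor product induced by a bounded bilinear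
map into a Banach space. -/
def projLift [CompleteSpace G] (B : E →L[ℂ] F →L[ℂ] G) : ProjTensor E F →L[ℂ] G :=
  ((algLift B).mkContinuous ‖B‖ (norm_algLift_le B)).extend
    (UniformSpace.Completion.toComplL : AlgTensor E F →L[ℂ] ProjTensor E F)

lemma projLift_coe [CompleteSpace G] (B : E →L[ℂ] F →L[ℂ] G) (u : AlgTensor E F) :
    projLift B (u : ProjTensor E F) = algLift B u :=
  ContinuousLinearMap.extend_eq _ UniformSpace.Completion.denseRange_coe
    (UniformSpace.Completion.isUniformInducing_coe _) u

end ProjectiveTensor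

/-! ### Hardy spaces on the circle -/

instance fact_two_pi_pos : Fact (0 < 2 * Real.pi) := ⟨Real.two_pi_pos⟩

variable (X : Type*) [NormedAddCommGroup X] [NormedSpace ℂ X]

/-- The Bochner space `L¹(𝕋; X)` of the circle `𝕋 = ℝ / 2πℤ` with normalized Haar measure. -/
abbrev L1 : Type _ :=
  Lp X 1 (AddCircle.haarAddCircle : Measure (AddCircle (2 * Real.pi)))

/-- The bounded bilinear map that sends `x ∈ X` and `f ∈ L¹(𝕋)` to the function
`θ ↦ f(θ) x` in `L¹(𝕋; X)`. -/
def scalarTimes : X →L[ℂ] L1 ℂ →L[ℂ] L1 X :=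
  (ContinuousLinearMap.lsmul ℂ ℂ).flip.compLpL₂ 1 AddCircle.haarAddCircle

variable {X} in
/-- The function `θ ↦ exp(inθ) x` in `L¹(𝕋; X)`. -/
def monomial (n : ℤ) (x : X) : L1 X := scalarTimes X x (fourierLp 1 n)

/-- The space of analytic polynomials `∑ₖ exp(ikθ) xₖ`, `k = 0, …, n`, with coefficients
in `X`. -/
def analyticPoly : Submodule ℂ (L1 X) :=
  Submodule.span ℂ {F | ∃ (k : ℕ) (x : X), F = monomial (k : ℤ) x}

/-- The Hardy space of `X`-valued functions: the closure in `L¹(𝕋; X)` of the analytic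
polynomials. -/
def Htilde : Submodule ℂ (L1 X) := (analyticPoly X).topologicalClosure

/-- The scalar Hardy space `H¹`, as a closed subspace of `L¹(𝕋)`. -/
abbrev H1 : Type := Htilde ℂ

instance [CompleteSpace X] : CompleteSpace (Htilde X) :=
  (Submodule.isClosed_topologicalClosure (analyticPoly X)).completeSpace_coe

lemma monomial_mem (k : ℕ) (x : X) : monomial (k : ℤ) x ∈ Htilde X :=
  Submodule.le_topologicalClosure _ (Submodule.subset_span ⟨k, x, rfl⟩)

lemma monomial_one (n : ℤ) : monomial n (1 : ℂ) = fourierLp 1 n := by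
  apply Lp.ext
  have h := ((ContinuousLinearMap.lsmul ℂ ℂ).flip (1 : ℂ)).coeFn_compLp
    (fourierLp 1 n : L1 ℂ)
  filter_upwards [h] with t ht
  exact ht.trans (by simp)

/-- The function `θ ↦ exp(ikθ)`, `k ≥ 0`, as an element of `H¹`. -/
def expH1 (k : ℕ) : H1 :=
  ⟨fourierLp 1 (k : ℤ), monomial_one (k : ℤ) ▸ monomial_mem ℂ k 1⟩

lemma scalarTimes_mem (x : X) (h : H1) : scalarTimes X x (h : L1 ℂ) ∈ Htilde X := by
  have hle : analyticPoly ℂ ≤ (Htilde X).comap (scalarTimes X x).toLinearMap := by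
    refine Submodule.span_le.2 ?_
    rintro _ ⟨k, z, rfl⟩
    have hz : monomial (k : ℤ) z = z • (fourierLp 1 (k : ℤ) : L1 ℂ) := by
      rw [← monomial_one]
      have : z = z • (1 : ℂ) := by simp
      conv_lhs => rw [this]
      simp only [monomial, map_smul]
      rfl
    change scalarTimes X x (monomial (k : ℤ) z) ∈ Htilde X
    rw [hz, map_smul]
    exact Submodule.smul_mem _ _ (monomial_mem X k x)
  have hc : IsClosed ((Htilde X).comap (scalarTimes X x).toLinearMap : Set (L1 ℂ)) :=
    (Submodule.isClosed_topologicalClosure (analyticPoly X)).preimage (scalarTimes X x).continuous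
  exact Submodule.topologicalClosure_minimal _ hle hc h.2

/-- The bounded bilinear map that sends `h ∈ H¹` and `x ∈ X` to the function
`θ ↦ h(θ) x` in the `X`-valued Hardy space. -/
def hardyTimes : H1 →L[ℂ] X →L[ℂ] Htilde X :=
  LinearMap.mkContinuous₂
    (LinearMap.mk₂ ℂ (fun (h : H1) (x : X) =>
        (⟨scalarTimes X x (h : L1 ℂ), scalarTimes_mem X x h⟩ : Htilde X))
      (fun h h' x => Subtype.ext (map_add (scalarTimes X x) _ _))
      (fun c h x => Subtype.ext (map_smul (scalarTimes X x) c _))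
      (fun h x x' => Subtype.ext (by simp))
      (fun c h x => Subtype.ext (by simp)))
    ‖scalarTimes X‖
    (fun h x => by
      have := (scalarTimes X).le_opNorm₂ x (h : L1 ℂ)
      rw [mul_right_comm] at this
      exact this)

variable [CompleteSpace X]

/-- The canonical map from the projective tensor product of `H¹` and `X` to the `X`-valued
Hardy space, which sends `h ⊗ x` to `θ ↦ h(θ) x`. -/
def canonicalMap : ProjTensor H1 X →L[ℂ] Htilde X := projLift (hardyTimes X)

lemma canonicalMap_tmul (h : H1) (x : X) :
    (canonicalMap X (tmul h x : AlgTensor H1 X) : L1 X) = scalarTimes X x (h : L1 ℂ) := by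
  rw [canonicalMap, projLift_coe, algLift_tmul]
  rfl

/-- `X` is `H¹`-projective if the canonical map is surjective. -/
def IsH1Projective : Prop := Function.Surjective (canonicalMap X)

/-- The `H¹`-projectivity constant of `X`: the smallest constant `c ≥ 0` such that
`‖F‖_{H¹ ⊗̂ X} ≤ c ‖F‖_{L¹(𝕋; X)}` for all `F` in the projective tensor product (meaningful if
`X` is `H¹`-projective). -/
def eta : ℝ := sInf {c : ℝ | 0 ≤ c ∧ ∀ F : ProjTensor H1 X, ‖F‖ ≤ c * ‖canonicalMap X F‖}

end

/-! ### Operators on `H¹` and `L¹` and their extensions -/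

section Operators

variable {Y : Type*} [NormedAddCommGroup Y] [NormedSpace ℂ Y]

/-- `w : L¹ → Y` extends `v : H¹ → Y`. -/
def Extends (w : L1 ℂ →L[ℂ] Y) (v : H1 →L[ℂ] Y) : Prop := ∀ h : H1, w (h : L1 ℂ) = v h

/-- The class of operators `v : H¹ → Y` for which there is a positive integer `N` such that
`v` vanishes at `exp(inθ)` for all `n > N`. -/
def FiniteSpectrumH1 (v : H1 →L[ℂ] Y) : Prop :=
  ∃ N : ℕ, 0 < N ∧ ∀ n : ℕ, N < n → v (expH1 n) = 0

/-- The class of operators `w : L¹ → Y` for which there is a positive integer `N` such that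
`w` vanishes at `exp(inθ)` for all integers `n` outside `[-N, N]`. -/
def FiniteSpectrumL1 (w : L1 ℂ →L[ℂ] Y) : Prop :=
  ∃ N : ℕ, 0 < N ∧ ∀ n : ℤ, n ∉ Set.Icc (-(N : ℤ)) N → w (fourierLp 1 n) = 0

variable (Y) in
/-- Every operator `v : H¹ → Y` has an extension `w : L¹ → Y` with `‖w‖ ≤ lam ‖v‖`. -/
def HasExtensions (lam : ℝ) : Prop :=
  ∀ v : H1 →L[ℂ] Y, ∃ w : L1 ℂ →L[ℂ] Y, Extends w v ∧ ‖w‖ ≤ lam * ‖v‖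

variable (Y) in
/-- Every operator `v : H¹ → Y` of finite spectrum has an extension `w : L¹ → Y` of finite
spectrum with `‖w‖ ≤ lam ‖v‖`. -/
def HasFiniteExtensions (lam : ℝ) : Prop :=
  ∀ v : H1 →L[ℂ] Y, FiniteSpectrumH1 v →
    ∃ w : L1 ℂ →L[ℂ] Y, FiniteSpectrumL1 w ∧ Extends w v ∧ ‖w‖ ≤ lam * ‖v‖

end Operators

end HOneProj

/-! The theorem is a duality statement. The dual of `ProjTensor H1 X` is the space of operators `H1
→ X*` with the operator norm (`ofProjTensor`, `projLift`), and every operator `w : L¹ → X*` acts on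
`L¹(𝕋; X)` as a functional of norm at most `‖w‖` (`bochnerFunctional`). If `w` extends `v`, this
functional composed with `canonicalMap` is `projLift v`. Testing a tensor `u` against a norming `v`
thus turns extensions with constant `λ` into `‖u‖ ≤ λ ‖canonicalMap X u‖`, which forces closed,
hence full, range. Conversely, once `canonicalMap` is an isomorphism, Hahn–Banach extends `projLift
v`, moved to `Htilde X`, to all of `L¹(𝕋; X)`, and restriction to functions `f(·)x` gives the
extension of `v` with constant `eta X`.

Fejér means, contractions on `L¹` that preserve `H1`, do the rest. Operators of finite spectrum
always extend, and `v ∘ fejerH1 N` tends to `v` when tested on any tensor; so `canonicalMap` is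
injective (`injective_canonicalMap`), and finite-spectrum extensions suffice for the norm bound. In
the other direction, `w ∘ fejer M` has finite spectrum and almost extends `v`; a finite-rank
correction of small norm repairs it (`HasExtensions.hasFiniteExtensions`). -/

namespace HOneProj

/-! ### Operators `L¹ → X*` as functionals on `L¹(𝕋; X)`. -/

section IndicatorMeasure

variable {X : Type*} [NormedAddCommGroup X] [NormedSpace ℂ X]

open Classical in
/-- The `X*`-valued set function `s ↦ w(1_s)` of an operator `w : L¹ → X*`. -/
noncomputable def indicatorMeasure (w : L1 ℂ →L[ℂ] StrongDual ℂ X)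
    (s : Set (AddCircle (2 * Real.pi))) : X →L[ℝ] ℂ :=
  if hs : MeasurableSet s then
    (w (indicatorConstLp 1 hs
      (measure_ne_top AddCircle.haarAddCircle s) (1 : ℂ))).restrictScalars ℝ
  else 0

lemma indicatorMeasure_apply (w : L1 ℂ →L[ℂ] StrongDual ℂ X)
    {s : Set (AddCircle (2 * Real.pi))} (hs : MeasurableSet s) (x : X) :
    indicatorMeasure w s x =
      w (indicatorConstLp 1 hs (measure_ne_top AddCircle.haarAddCircle s) (1 : ℂ)) x := by
  rw [indicatorMeasure, dif_pos hs]
  rfl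

/-- The constant is `‖w‖` because the indicator of `s` has `L¹` norm equal to the measure of `s`. -/
lemma dominatedFinMeasAdditive_indicatorMeasure (w : L1 ℂ →L[ℂ] StrongDual ℂ X) :
    DominatedFinMeasAdditive AddCircle.haarAddCircle (indicatorMeasure w) ‖w‖ := by
  refine ⟨fun s t hs ht _ _ hst => ?_, fun s hs _ => ?_⟩
  · ext x
    rw [add_apply, indicatorMeasure_apply w (hs.union ht),
      indicatorMeasure_apply w hs, indicatorMeasure_apply w ht,
      indicatorConstLp_disjoint_union hs ht (measure_ne_top _ _) (measure_ne_top _ _) hst,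
      map_add]
    rfl
  · refine ContinuousLinearMap.opNorm_le_bound _ (by positivity) fun x => ?_
    rw [indicatorMeasure_apply w hs]
    refine (ContinuousLinearMap.le_opNorm _ _).trans ?_
    gcongr
    refine (w.le_opNorm _).trans ?_
    gcongr
    rw [norm_indicatorConstLp one_ne_zero ENNReal.one_ne_top]
    simp

/-- The functional on `L¹(𝕋; X)` determined by an operator `w : L¹ → X*`. -/
noncomputable def bochnerFunctional (w : L1 ℂ →L[ℂ] StrongDual ℂ X) : L1 X →L[ℂ] ℂ :=
  L1.setToL1' ℂ (dominatedFinMeasAdditive_indicatorMeasure w) (by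
    intro c s x
    by_cases hs : MeasurableSet s
    · rw [indicatorMeasure_apply w hs, indicatorMeasure_apply w hs, map_smul]
    · simp [indicatorMeasure, hs])

lemma bochnerFunctional_eq (w : L1 ℂ →L[ℂ] StrongDual ℂ X) (F : L1 X) :
    bochnerFunctional w F = L1.setToL1 (dominatedFinMeasAdditive_indicatorMeasure w) F :=
  (L1.setToL1_eq_setToL1' _ _ F).symm

lemma norm_bochnerFunctional_apply_le (w : L1 ℂ →L[ℂ] StrongDual ℂ X) (F : L1 X) :
    ‖bochnerFunctional w F‖ ≤ ‖w‖ * ‖F‖ := by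
  rw [bochnerFunctional_eq]
  exact L1.norm_setToL1_le_mul_norm _ (norm_nonneg w) F

lemma coeFn_scalarTimes (x : X) (f : L1 ℂ) :
    scalarTimes X x f =ᵐ[AddCircle.haarAddCircle] fun t => f t • x :=
  ((ContinuousLinearMap.lsmul ℂ ℂ).flip x).coeFn_compLp f

lemma scalarTimes_indicator (x : X) (c : ℂ) {s : Set (AddCircle (2 * Real.pi))}
    (hs : MeasurableSet s) :
    scalarTimes X x (indicatorConstLp 1 hs (measure_ne_top AddCircle.haarAddCircle s) c) =
      indicatorConstLp 1 hs (measure_ne_top AddCircle.haarAddCircle s) (c • x) := by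
  apply Lp.ext
  filter_upwards [coeFn_scalarTimes x
    (indicatorConstLp 1 hs (measure_ne_top AddCircle.haarAddCircle s) c),
    indicatorConstLp_coeFn (p := 1) (hs := hs)
      (hμs := measure_ne_top AddCircle.haarAddCircle s) (c := c),
    indicatorConstLp_coeFn (p := 1) (hs := hs)
      (hμs := measure_ne_top AddCircle.haarAddCircle s) (c := c • x)] with t h1 h2 h3
  rw [h1, h2, h3]
  by_cases ht : t ∈ s <;> simp [ht]

lemma indicatorConstLp_eq_smul_one (c : ℂ) {s : Set (AddCircle (2 * Real.pi))}
    (hs : MeasurableSet s) :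
    (indicatorConstLp 1 hs (measure_ne_top AddCircle.haarAddCircle s) c : L1 ℂ) =
      c • indicatorConstLp 1 hs (measure_ne_top AddCircle.haarAddCircle s) (1 : ℂ) := by
  have := scalarTimes_indicator c (1 : ℂ) hs
  rw [smul_eq_mul, one_mul] at this
  rw [← this]
  apply Lp.ext
  filter_upwards [coeFn_scalarTimes c
      (indicatorConstLp 1 hs (measure_ne_top AddCircle.haarAddCircle s) (1 : ℂ)),
    Lp.coeFn_smul c
      (indicatorConstLp 1 hs (measure_ne_top AddCircle.haarAddCircle s) (1 : ℂ))] with t h1 h2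
  rw [h1, h2, Pi.smul_apply, smul_eq_mul, smul_eq_mul, mul_comm]

/-- Both sides are continuous and additive in `f` and agree on multiples of indicators. -/
lemma bochnerFunctional_scalarTimes (w : L1 ℂ →L[ℂ] StrongDual ℂ X) (x : X) (f : L1 ℂ) :
    bochnerFunctional w (scalarTimes X x f) = w f x := by
  induction f using Lp.induction ENNReal.one_ne_top with
  | indicatorConst c hs hμs =>
    rw [Lp.simpleFunc.coe_indicatorConst, scalarTimes_indicator, bochnerFunctional_eq,
      L1.setToL1_indicatorConstLp, indicatorMeasure_apply w hs,
      indicatorConstLp_eq_smul_one c hs]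
    simp
  | add hf hg _ h1 h2 => simp [h1, h2]
  | isClosed =>
    exact isClosed_eq (by fun_prop)
      (((ContinuousLinearMap.apply ℂ ℂ x).continuous).comp w.continuous)

/-- Constant 1 matters: it lets `hasExtensions_eta` attain exactly `eta X`. -/
lemma norm_scalarTimes_le (x : X) (f : L1 ℂ) : ‖scalarTimes X x f‖ ≤ ‖f‖ * ‖x‖ := by
  have h : ‖(ContinuousLinearMap.lsmul ℂ ℂ).flip x‖ ≤ ‖x‖ := by
    refine ContinuousLinearMap.opNorm_le_bound _ (norm_nonneg x) fun c => ?_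
    simp [norm_smul, mul_comm]
  refine (ContinuousLinearMap.norm_compLp_le _ _).trans ?_
  rw [mul_comm ‖f‖]
  gcongr

end IndicatorMeasure

/-! ### Duality between the projective tensor product and operators into `X*`. -/

section TensorDuality

variable {E F G : Type*} [NormedAddCommGroup E] [NormedSpace ℂ E]
  [NormedAddCommGroup F] [NormedSpace ℂ F] [NormedAddCommGroup G] [NormedSpace ℂ G]
  [CompleteSpace G]

lemma norm_projLift_apply_le (B : E →L[ℂ] F →L[ℂ] G) (u : ProjTensor E F) :
    ‖projLift B u‖ ≤ ‖B‖ * ‖u‖ := by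
  induction u using UniformSpace.Completion.induction_on with
  | hp => exact isClosed_le (by fun_prop) (by fun_prop)
  | ih u =>
    rw [projLift_coe, UniformSpace.Completion.norm_coe]
    exact norm_algLift_le B u

lemma norm_tmul_le (x : E) (y : F) : ‖tmul x y‖ ≤ ‖x‖ * ‖y‖ := by
  have := projNorm_le [(x, y)]
  simp only [repTensor, repCost, List.map_cons, List.map_nil, List.sum_cons, List.sum_nil,
    add_zero] at this
  exact this

/-- The class of `x ⊗ y` in the projective tensor product. -/
noncomputable def pureTensor (x : E) (y : F) : ProjTensor E F := (tmul x y : AlgTensor E F)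

lemma projLift_pureTensor (B : E →L[ℂ] F →L[ℂ] G) (x : E) (y : F) :
    projLift B (pureTensor x y) = B x y := by
  rw [pureTensor, projLift_coe, algLift_tmul]

lemma pureTensor_dense (S : Submodule ℂ (ProjTensor E F)) (hS : IsClosed (S : Set (ProjTensor E F)))
    (h : ∀ x y, pureTensor x y ∈ S) (u : ProjTensor E F) : u ∈ S := by
  induction u using UniformSpace.Completion.induction_on with
  | hp => exact hS
  | ih u =>
    obtain ⟨l, rfl⟩ := exists_repTensor u
    induction l with
    | nil => exact S.zero_mem
    | cons p l ih =>
      have h1 : repTensor (p :: l) = tmul p.1 p.2 + repTensor l := by simp [repTensor]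
      rw [h1, UniformSpace.Completion.coe_add]
      exact S.add_mem (h _ _) ih

lemma ext_pureTensor {φ ψ : ProjTensor E F →L[ℂ] G}
    (h : ∀ x y, φ (pureTensor x y) = ψ (pureTensor x y)) : φ = ψ := by
  ext u
  exact pureTensor_dense (LinearMap.eqLocus (φ : ProjTensor E F →ₗ[ℂ] G) (ψ : ProjTensor E F →ₗ[ℂ] G)) (isClosed_eq φ.continuous ψ.continuous) h u

/-- The bilinear map `(x, y) ↦ φ(x ⊗ y)` of a bounded linear map on the projective tensor
product. -/
noncomputable def ofProjTensor (φ : ProjTensor E F →L[ℂ] G) : E →L[ℂ] F →L[ℂ] G :=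
  LinearMap.mkContinuous₂
    (LinearMap.mk₂ ℂ (fun x y => φ (pureTensor x y))
      (fun x x' y => by
        rw [← map_add, pureTensor, pureTensor, pureTensor, ← UniformSpace.Completion.coe_add]
        congr 2; exact TensorProduct.add_tmul _ _ _)
      (fun c x y => by
        rw [← map_smul, pureTensor, pureTensor, ← UniformSpace.Completion.coe_smul]
        congr 1)
      (fun x y y' => by
        rw [← map_add, pureTensor, pureTensor, pureTensor, ← UniformSpace.Completion.coe_add]
        congr 2; exact TensorProduct.tmul_add _ _ _)
      (fun c x y => by
        rw [← map_smul, pureTensor, pureTensor, ← UniformSpace.Completion.coe_smul]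
        congr 2; exact TensorProduct.tmul_smul _ _ _))
    ‖φ‖ (fun x y => by
      rw [mul_assoc]
      refine (φ.le_opNorm _).trans ?_
      gcongr
      rw [pureTensor, UniformSpace.Completion.norm_coe]
      exact norm_tmul_le x y)

lemma ofProjTensor_apply (φ : ProjTensor E F →L[ℂ] G) (x : E) (y : F) :
    ofProjTensor φ x y = φ (pureTensor x y) := rfl

lemma norm_ofProjTensor_le (φ : ProjTensor E F →L[ℂ] G) : ‖ofProjTensor φ‖ ≤ ‖φ‖ :=
  LinearMap.mkContinuous₂_norm_le _ (norm_nonneg φ) _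

lemma projLift_ofProjTensor (φ : ProjTensor E F →L[ℂ] G) : projLift (ofProjTensor φ) = φ :=
  ext_pureTensor fun x y => by rw [projLift_pureTensor, ofProjTensor_apply]

variable {X : Type*} [NormedAddCommGroup X] [NormedSpace ℂ X] [CompleteSpace X]

lemma coe_canonicalMap_pureTensor (h : H1) (x : X) :
    (canonicalMap X (pureTensor h x) : L1 X) = scalarTimes X x (h : L1 ℂ) :=
  canonicalMap_tmul X h x

/-- Both sides are continuous in `u` and agree on pure tensors. Hence, when `v` extends, its pairing
with `u` depends only on the function that `u` represents. -/
lemma bochnerFunctional_canonicalMap {w : L1 ℂ →L[ℂ] StrongDual ℂ X}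
    {v : H1 →L[ℂ] StrongDual ℂ X} (hwv : Extends w v) (u : ProjTensor H1 X) :
    bochnerFunctional w (canonicalMap X u : L1 X) = projLift v u := by
  have : (bochnerFunctional w ∘L (Htilde X).subtypeL) ∘L canonicalMap X = projLift v := by
    refine ext_pureTensor fun h x => ?_
    rw [projLift_pureTensor, ← hwv h, ← bochnerFunctional_scalarTimes w x (h : L1 ℂ),
      ← coe_canonicalMap_pureTensor]
    rfl
  exact DFunLike.congr_fun this u

lemma norm_projLift_apply_le_of_extends {w : L1 ℂ →L[ℂ] StrongDual ℂ X}
    {v : H1 →L[ℂ] StrongDual ℂ X} (hwv : Extends w v) (u : ProjTensor H1 X) :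
    ‖projLift v u‖ ≤ ‖w‖ * ‖canonicalMap X u‖ := by
  rw [← bochnerFunctional_canonicalMap hwv]
  exact norm_bochnerFunctional_apply_le w _

/-- A tensor `u` is normed by an operator `v : H¹ → X*` of norm at most one. -/
lemma exists_operator_norming (u : ProjTensor H1 X) :
    ∃ v : H1 →L[ℂ] StrongDual ℂ X, ‖v‖ ≤ 1 ∧ projLift v u = ‖u‖ := by
  obtain ⟨φ, hφ, hu⟩ := exists_dual_vector'' ℂ u
  refine ⟨ofProjTensor φ, (norm_ofProjTensor_le φ).trans hφ, ?_⟩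
  rw [projLift_ofProjTensor, hu]
  rfl

end TensorDuality

/-! ### Fejér means as contractions of `L¹`. -/

section Fejer

open Filter Topology AddCircle
open scoped ENNReal

lemma integral_fourier (n : ℤ) :
    ∫ t : AddCircle (2 * Real.pi), fourier n t ∂haarAddCircle = if n = 0 then 1 else 0 := by
  split_ifs with h
  · subst h
    simp
  · exact integral_eq_zero_of_add_right_eq_neg (μ := haarAddCircle)
      (fourier_add_half_inv_index h Real.two_pi_pos)

lemma norm_fourierLp_one (n : ℤ) : ‖(fourierLp 1 n : L1 ℂ)‖ = 1 := by
  have h : ∀ᵐ t ∂(haarAddCircle : Measure (AddCircle (2 * Real.pi))),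
      ‖(fourierLp 1 n : L1 ℂ) t‖ = 1 := by
    filter_upwards [coeFn_fourierLp (T := 2 * Real.pi) 1 n] with t ht
    rw [ht]
    exact Circle.norm_coe _
  rw [L1.norm_eq_integral_norm, integral_congr_ae h]
  simp

/-- The `n`-th Fourier coefficient as a bounded functional on `L¹`. -/
noncomputable def coeff (n : ℤ) : L1 ℂ →L[ℂ] ℂ :=
  LinearMap.mkContinuous
    { toFun := fun f => fourierCoeff f n
      map_add' := fun f g => by
        rw [← Pi.add_apply, ← fourierCoeff.add (L1.integrable_coeFn f) (L1.integrable_coeFn g)]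
        exact integral_congr_ae (by
          filter_upwards [Lp.coeFn_add f g] with t ht
          rw [ht])
      map_smul' := fun c f => by
        rw [RingHom.id_apply, smul_eq_mul, fourierCoeff, fourierCoeff, ← integral_const_mul]
        exact integral_congr_ae (by
          filter_upwards [Lp.coeFn_smul c f] with t ht
          rw [ht, Pi.smul_apply, smul_eq_mul, smul_eq_mul, smul_eq_mul]
          ring) }
    1 (fun f => by
      rw [one_mul, L1.norm_eq_integral_norm]
      refine (norm_integral_le_integral_norm _).trans_eq (integral_congr_ae ?_)
      filter_upwards with t
      rw [norm_smul, fourier_apply, Circle.norm_coe, one_mul])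

lemma coeff_apply (n : ℤ) (f : L1 ℂ) :
    coeff n f = ∫ t, fourier (-n) t * f t ∂haarAddCircle := rfl

lemma norm_coeff_apply_le (n : ℤ) (f : L1 ℂ) : ‖coeff n f‖ ≤ ‖f‖ := by
  simpa using (LinearMap.mkContinuous_norm_le _ zero_le_one _ : ‖coeff n‖ ≤ 1)
    |> fun h => (coeff n).le_of_opNorm_le h f

lemma coeff_fourierLp (n m : ℤ) : coeff n (fourierLp 1 m) = if m = n then 1 else 0 := by
  have h : ∫ t, fourier (-n) t * (fourierLp 1 m : L1 ℂ) t ∂haarAddCircle =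
      ∫ t : AddCircle (2 * Real.pi), fourier (m - n) t ∂haarAddCircle := by
    refine integral_congr_ae ?_
    filter_upwards [coeFn_fourierLp (T := 2 * Real.pi) 1 m] with t ht
    rw [ht, ← fourier_add, neg_add_eq_sub]
  rw [coeff_apply, h, integral_fourier]
  simp [sub_eq_zero]

/-- The Fejér kernel `N⁻¹ ∑ exp(i(j-k)θ)`, `0 ≤ j, k < N`. -/
noncomputable def fejerKernel (N : ℕ) : C(AddCircle (2 * Real.pi), ℂ) :=
  (N : ℂ)⁻¹ • ∑ j ∈ Finset.range N, ∑ k ∈ Finset.range N, fourier ((j : ℤ) - k)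

/-- The `N`-th Fejér mean. -/
noncomputable def fejer (N : ℕ) : L1 ℂ →L[ℂ] L1 ℂ :=
  (N : ℂ)⁻¹ • ∑ j ∈ Finset.range N, ∑ k ∈ Finset.range N,
    (coeff ((j : ℤ) - k)).smulRight (fourierLp 1 ((j : ℤ) - k))

lemma fejerKernel_apply (N : ℕ) (t : AddCircle (2 * Real.pi)) :
    fejerKernel N t =
      (N : ℂ)⁻¹ * ∑ j ∈ Finset.range N, ∑ k ∈ Finset.range N, fourier ((j : ℤ) - k) t := by
  simp only [fejerKernel, ContinuousMap.smul_apply, ContinuousMap.sum_apply, smul_eq_mul]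

/-- The double sum over `j - k` is the product of a Dirichlet-type sum with its conjugate, so the
kernel is nonnegative and its `L¹` norm is its integral. -/
lemma fejerKernel_eq_ofReal (N : ℕ) (t : AddCircle (2 * Real.pi)) :
    fejerKernel N t =
      (((N : ℝ)⁻¹ * ‖∑ j ∈ Finset.range N, fourier (j : ℤ) t‖ ^ 2 : ℝ) : ℂ) := by
  rw [fejerKernel_apply]
  push_cast
  rw [← Complex.mul_conj', map_sum, Finset.sum_mul_sum]
  congr 1
  refine Finset.sum_congr rfl fun j _ => Finset.sum_congr rfl fun k _ => ?_
  rw [← fourier_neg, ← fourier_add, sub_eq_add_neg]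

lemma norm_fejerKernel (N : ℕ) (t : AddCircle (2 * Real.pi)) :
    ((‖fejerKernel N t‖ : ℝ) : ℂ) = fejerKernel N t := by
  rw [fejerKernel_eq_ofReal, Complex.norm_real, Real.norm_of_nonneg (by positivity)]

lemma integrable_fourier (n : ℤ) :
    Integrable (fun t : AddCircle (2 * Real.pi) => fourier n t) haarAddCircle :=
  (fourier n).continuous.integrable_of_hasCompactSupport (HasCompactSupport.of_compactSpace _)

/-- Only the `N` diagonal terms have nonzero integral. The value is 1 except for `N = 0`, where the
kernel vanishes. -/
lemma integral_norm_fejerKernel_le (N : ℕ) :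
    ∫ t, ‖fejerKernel N t‖ ∂haarAddCircle ≤ 1 := by
  have h : ((∫ t, ‖fejerKernel N t‖ ∂haarAddCircle : ℝ) : ℂ) = (N : ℂ)⁻¹ * N := by
    rw [← integral_complex_ofReal]
    simp_rw [norm_fejerKernel, fejerKernel_apply]
    rw [integral_const_mul, integral_finsetSum _ fun j _ =>
      integrable_finsetSum _ fun k _ => integrable_fourier _]
    congr 1
    calc _ = ∑ j ∈ Finset.range N, (1 : ℂ) := by
          refine Finset.sum_congr rfl fun j hj => ?_
          rw [integral_finsetSum _ fun k _ => integrable_fourier _]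
          simp_rw [integral_fourier, sub_eq_zero, Nat.cast_inj]
          rw [Finset.sum_ite_eq, if_pos hj]
      _ = N := by simp
  have h' : ∫ t, ‖fejerKernel N t‖ ∂haarAddCircle = (N : ℝ)⁻¹ * N :=
    Complex.ofReal_injective (by rw [h]; push_cast; rfl)
  rw [h']
  exact inv_mul_le_one

lemma lintegral_enorm_fejerKernel_le (N : ℕ) :
    ∫⁻ t, ‖fejerKernel N t‖ₑ ∂haarAddCircle ≤ 1 := by
  have hi : Integrable (fejerKernel N) haarAddCircle :=
    (fejerKernel N).continuous.integrable_of_hasCompactSupport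
      (HasCompactSupport.of_compactSpace _)
  rw [← ofReal_integral_norm_eq_lintegral_enorm hi]
  exact ENNReal.ofReal_le_one.2 (integral_norm_fejerKernel_le N)

lemma coeFn_fejer (N : ℕ) (f : L1 ℂ) :
    fejer N f =ᵐ[haarAddCircle] fun x => ∫ t, fejerKernel N (x - t) * f t ∂haarAddCircle := by
  let g : C(AddCircle (2 * Real.pi), ℂ) :=
    (N : ℂ)⁻¹ • ∑ j ∈ Finset.range N, ∑ k ∈ Finset.range N,
      coeff ((j : ℤ) - k) f • fourier ((j : ℤ) - k)
  have hg : fejer N f = ContinuousMap.toLp (E := ℂ) 1 haarAddCircle ℂ g := by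
    simp [g, fejer]
  rw [hg]
  filter_upwards [ContinuousMap.coeFn_toLp (p := 1) (𝕜 := ℂ)
    (haarAddCircle : Measure (AddCircle (2 * Real.pi))) g] with x hx
  rw [hx]
  have key : ∀ n : ℤ, ∀ t, fourier n (x - t) * f t = fourier n x * (fourier (-n) t * f t) := by
    intro n t
    have : fourier n (x - t) = fourier n x * fourier (-n) t := by
      rw [fourier_apply, fourier_apply, fourier_apply, zsmul_sub, sub_eq_add_neg, neg_smul,
        toCircle_add, Circle.coe_mul]
    rw [this, mul_assoc]
  have hint : ∀ n : ℤ, Integrable (fun t => fourier n x * (fourier (-n) t * f t))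
      haarAddCircle := fun n =>
    ((L1.integrable_coeFn f).fourier_smul (-n)).const_mul _
  simp_rw [fejerKernel_apply, mul_assoc, Finset.sum_mul, key]
  rw [integral_const_mul, integral_finsetSum _ fun j _ =>
    integrable_finsetSum _ fun k _ => hint _]
  simp only [g, ContinuousMap.smul_apply, ContinuousMap.sum_apply, smul_eq_mul]
  congr 1
  refine Finset.sum_congr rfl fun j _ => ?_
  rw [integral_finsetSum _ fun k _ => hint _]
  refine Finset.sum_congr rfl fun k _ => ?_
  rw [integral_const_mul, ← coeff_apply, mul_comm]

/-- Young's inequality for convolution with a kernel of `L¹` norm at most 1, by Tonelli and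
translation invariance. -/
lemma norm_fejer_apply_le (N : ℕ) (f : L1 ℂ) : ‖fejer N f‖ ≤ ‖f‖ := by
  have hf : AEMeasurable (fun t => ‖f t‖ₑ) (haarAddCircle : Measure (AddCircle (2 * Real.pi))) :=
    (Lp.aestronglyMeasurable f).enorm
  have hK : Measurable fun t => ‖fejerKernel N t‖ₑ :=
    (fejerKernel N).continuous.measurable.enorm
  have : ‖fejer N f‖ₑ ≤ ‖f‖ₑ := by
    rw [Lp.enorm_def, Lp.enorm_def, eLpNorm_one_eq_lintegral_enorm, eLpNorm_one_eq_lintegral_enorm]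
    calc ∫⁻ x, ‖fejer N f x‖ₑ ∂haarAddCircle
        = ∫⁻ x, ‖∫ t, fejerKernel N (x - t) * f t ∂haarAddCircle‖ₑ ∂haarAddCircle := by
          refine lintegral_congr_ae ?_
          filter_upwards [coeFn_fejer N f] with x hx
          rw [hx]
      _ ≤ ∫⁻ x, ∫⁻ t, ‖fejerKernel N (x - t)‖ₑ * ‖f t‖ₑ ∂haarAddCircle ∂haarAddCircle := by
          refine lintegral_mono fun x => ?_
          simpa only [enorm_mul] using
            enorm_integral_le_lintegral_enorm (μ := haarAddCircle)
              (fun t => fejerKernel N (x - t) * f t)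
      _ = ∫⁻ t, ∫⁻ x, ‖fejerKernel N (x - t)‖ₑ * ‖f t‖ₑ ∂haarAddCircle ∂haarAddCircle := by
          refine lintegral_lintegral_swap ?_
          exact (hK.comp (measurable_fst.sub measurable_snd)).aemeasurable.mul hf.comp_snd
      _ = ∫⁻ t, (∫⁻ x, ‖fejerKernel N x‖ₑ ∂haarAddCircle) * ‖f t‖ₑ ∂haarAddCircle := by
          refine lintegral_congr fun t => ?_
          rw [lintegral_mul_const _
              (show Measurable fun x => ‖fejerKernel N (x - t)‖ₑ from
                hK.comp (measurable_id.sub_const t)),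
            lintegral_sub_right_eq_self (fun x => ‖fejerKernel N x‖ₑ) t]
      _ ≤ ∫⁻ t, 1 * ‖f t‖ₑ ∂haarAddCircle := by
          gcongr
          exact lintegral_enorm_fejerKernel_le N
      _ = ∫⁻ t, ‖f t‖ₑ ∂haarAddCircle := by simp
  simpa [enorm_le_iff_norm_le] using this

/-- The `n`-th Fourier coefficient of the `N`-th Fejér kernel. -/
noncomputable def fejerCoeff (N : ℕ) (n : ℤ) : ℂ :=
  (N : ℂ)⁻¹ * ∑ j ∈ Finset.range N, ∑ k ∈ Finset.range N, if n = (j : ℤ) - k then 1 else 0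

lemma fejer_fourierLp (N : ℕ) (n : ℤ) :
    fejer N (fourierLp 1 n) = fejerCoeff N n • (fourierLp 1 n : L1 ℂ) := by
  simp only [fejer, fejerCoeff, smul_apply, sum_apply,
    ContinuousLinearMap.smulRight_apply, coeff_fourierLp, mul_smul, Finset.sum_smul]
  congr 1
  refine Finset.sum_congr rfl fun j _ => Finset.sum_congr rfl fun k _ => ?_
  split_ifs with h
  · rw [h]
  · simp

lemma fejerCoeff_eq_zero {N : ℕ} {n : ℤ} (hn : n ∉ Icc (-(N : ℤ)) N) : fejerCoeff N n = 0 := by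
  rw [fejerCoeff, Finset.sum_eq_zero, mul_zero]
  refine fun j hj => Finset.sum_eq_zero fun k hk => if_neg ?_
  rw [Finset.mem_range] at hj hk
  rw [mem_Icc] at hn
  omega

lemma fejerCoeff_natCast {N n : ℕ} (hn : n ≤ N) :
    fejerCoeff N n = (N : ℂ)⁻¹ * (N - n) := by
  -- With `j` innermost, each `k` admits the single solution `j = n + k`, which lies in range
  -- exactly when `k < N - n`.
  rw [fejerCoeff, Finset.sum_comm]
  congr 1
  have h : ∀ k ∈ Finset.range N,
      (∑ j ∈ Finset.range N, if (n : ℤ) = (j : ℤ) - k then (1 : ℂ) else 0) =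
        if k < N - n then 1 else 0 := by
    intro k _
    have : ∀ j : ℕ, ((n : ℤ) = (j : ℤ) - k) = (n + k = j) := fun j => by
      apply propext; omega
    simp_rw [this]
    rw [Finset.sum_ite_eq]
    refine if_congr ?_ rfl rfl
    rw [Finset.mem_range]
    omega
  rw [Finset.sum_congr rfl h, ← Finset.sum_filter]
  have hfilter : (Finset.range N).filter (fun k => k < N - n) = Finset.range (N - n) := by
    ext k
    simp only [Finset.mem_filter, Finset.mem_range]
    omega
  rw [hfilter]
  simp [Nat.cast_sub hn]

lemma tendsto_fejerCoeff (n : ℕ) : Tendsto (fun N => fejerCoeff N n) atTop (𝓝 1) := by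
  have h : Tendsto (fun N : ℕ => 1 - (n : ℂ) * (N : ℂ)⁻¹) atTop (𝓝 (1 - n * 0)) :=
    tendsto_const_nhds.sub (tendsto_const_nhds.mul tendsto_inv_atTop_nhds_zero_nat)
  rw [mul_zero, sub_zero] at h
  refine h.congr' ?_
  filter_upwards [eventually_ge_atTop (n + 1)] with N hN
  have hN0 : (N : ℂ) ≠ 0 := Nat.cast_ne_zero.2 (by omega)
  rw [fejerCoeff_natCast (by omega)]
  field_simp

end Fejer

/-! ### Fejér means on `H1`, and extension of operators from `H1`. -/

section HardyOperators

open Filter Topology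

lemma mem_of_forall_monomial_mem {X : Type*} [NormedAddCommGroup X] [NormedSpace ℂ X]
    (S : Submodule ℂ (Htilde X)) (hS : IsClosed (S : Set (Htilde X)))
    (h : ∀ (k : ℕ) (x : X), (⟨monomial k x, monomial_mem X k x⟩ : Htilde X) ∈ S)
    (F : Htilde X) : F ∈ S := by
  have hle : analyticPoly X ≤ S.map (Htilde X).subtype := by
    refine Submodule.span_le.2 ?_
    rintro _ ⟨k, x, rfl⟩
    exact ⟨_, h k x, rfl⟩
  have hF : (F : L1 X) ∈ closure (analyticPoly X : Set (L1 X)) := F.2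
  obtain ⟨p, hp, hlim⟩ := mem_closure_iff_seq_limit.1 hF
  choose q hq hqp using fun n => hle (hp n)
  refine hS.mem_of_tendsto (b := atTop) (f := q) ?_ (Eventually.of_forall hq)
  rw [tendsto_subtype_rng]
  exact hlim.congr fun n => (hqp n).symm

lemma monomial_eq_smul_expH1 (k : ℕ) (z : ℂ) :
    (⟨monomial k z, monomial_mem ℂ k z⟩ : H1) = z • expH1 k := by
  apply Subtype.ext
  change monomial (k : ℤ) z = z • (fourierLp 1 (k : ℤ) : L1 ℂ)
  have h : monomial (k : ℤ) z = z • monomial (k : ℤ) (1 : ℂ) := by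
    conv_lhs => rw [← mul_one z, ← smul_eq_mul]
    simp only [monomial, map_smul]
    rfl
  rw [h, monomial_one]

lemma mem_of_forall_expH1_mem (S : Submodule ℂ H1) (hS : IsClosed (S : Set H1))
    (h : ∀ k, expH1 k ∈ S) (f : H1) : f ∈ S :=
  mem_of_forall_monomial_mem S hS
    (fun k z => monomial_eq_smul_expH1 k z ▸ S.smul_mem z (h k)) f

lemma norm_expH1 (k : ℕ) : ‖expH1 k‖ = 1 := norm_fourierLp_one k

variable {Y : Type*} [NormedAddCommGroup Y] [NormedSpace ℂ Y]

lemma extends_of_expH1 {w : L1 ℂ →L[ℂ] Y} {v : H1 →L[ℂ] Y}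
    (h : ∀ k : ℕ, w (fourierLp 1 (k : ℤ)) = v (expH1 k)) : Extends w v :=
  mem_of_forall_expH1_mem
    (LinearMap.eqLocus (w ∘L (Htilde ℂ).subtypeL : H1 →ₗ[ℂ] Y) (v : H1 →ₗ[ℂ] Y))
    (isClosed_eq (w ∘L (Htilde ℂ).subtypeL).continuous v.continuous) h

lemma fejer_mem (N : ℕ) (h : H1) : fejer N (h : L1 ℂ) ∈ Htilde ℂ := by
  refine mem_of_forall_expH1_mem
    ((Htilde ℂ).comap (fejer N ∘L (Htilde ℂ).subtypeL : H1 →ₗ[ℂ] L1 ℂ)) ?_ (fun k => ?_) h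
  · exact (Submodule.isClosed_topologicalClosure (analyticPoly ℂ)).preimage
      (fejer N ∘L (Htilde ℂ).subtypeL).continuous
  · change fejer N (fourierLp 1 (k : ℤ)) ∈ Htilde ℂ
    rw [fejer_fourierLp]
    exact (Htilde ℂ).smul_mem _ (expH1 k).2

/-- The `N`-th Fejér mean on the Hardy space. -/
noncomputable def fejerH1 (N : ℕ) : H1 →L[ℂ] H1 :=
  (fejer N ∘L (Htilde ℂ).subtypeL).codRestrict (Htilde ℂ) (fejer_mem N)

lemma norm_fejerH1_apply_le (N : ℕ) (h : H1) : ‖fejerH1 N h‖ ≤ ‖h‖ :=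
  norm_fejer_apply_le N h

lemma norm_comp_fejerH1_le (v : H1 →L[ℂ] Y) (N : ℕ) : ‖v ∘L fejerH1 N‖ ≤ ‖v‖ := by
  refine ContinuousLinearMap.opNorm_le_bound _ (norm_nonneg v) fun h => ?_
  exact (v.le_opNorm _).trans (by gcongr; exact norm_fejerH1_apply_le N h)

lemma fejerH1_expH1 (N k : ℕ) : fejerH1 N (expH1 k) = fejerCoeff N k • expH1 k :=
  Subtype.ext (fejer_fourierLp N k)

lemma finiteSpectrumH1_comp_fejerH1 (v : H1 →L[ℂ] Y) (N : ℕ) :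
    FiniteSpectrumH1 (v ∘L fejerH1 N) := by
  -- `N + 1` rather than `N`, because the bound must be positive even when `N = 0`.
  refine ⟨N + 1, by omega, fun n hn => ?_⟩
  rw [ContinuousLinearMap.comp_apply, fejerH1_expH1, fejerCoeff_eq_zero, zero_smul, map_zero]
  rw [mem_Icc]
  omega

/-- A uniform bound makes the operators equicontinuous, so convergence need only be checked on a set
with dense span. -/
lemma isClosed_setOf_tendsto_of_norm_le {E G : Type*} [NormedAddCommGroup E] [NormedSpace ℂ E]
    [NormedAddCommGroup G] [NormedSpace ℂ G] {T : ℕ → E →L[ℂ] G} {S : E →L[ℂ] G} {C : ℝ}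
    (hC : ∀ n x, ‖T n x‖ ≤ C * ‖x‖) :
    IsClosed {x | Tendsto (fun n => T n x) atTop (𝓝 (S x))} := by
  have hlip : ∀ n, LipschitzWith C.toNNReal (T n) := fun n =>
    AddMonoidHomClass.lipschitz_of_bound (T n) C (hC n)
  exact (LipschitzWith.uniformEquicontinuous (fun n => ⇑(T n)) _ hlip).equicontinuous
    |>.isClosed_setOfPred_tendsto S.continuous

/-- The submodule of vectors on which a sequence of operators converges to an operator. -/
def tendstoSubmodule {E G : Type*} [NormedAddCommGroup E] [NormedSpace ℂ E]
    [NormedAddCommGroup G] [NormedSpace ℂ G] (T : ℕ → E →L[ℂ] G) (S : E →L[ℂ] G) :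
    Submodule ℂ E where
  carrier := {x | Tendsto (fun n => T n x) atTop (𝓝 (S x))}
  add_mem' {x y} hx hy := by
    simpa only [mem_ofPred_eq, map_add] using Tendsto.add hx hy
  zero_mem' := by simp
  smul_mem' c x hx := by
    simpa only [mem_ofPred_eq, map_smul] using Tendsto.const_smul hx c

lemma tendsto_fejerH1 (h : H1) : Tendsto (fun N => fejerH1 N h) atTop (𝓝 h) := by
  refine mem_of_forall_expH1_mem (tendstoSubmodule fejerH1 (ContinuousLinearMap.id ℂ H1))
    (isClosed_setOf_tendsto_of_norm_le (C := 1)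
      fun n x => by simpa using norm_fejerH1_apply_le n x) (fun k => ?_) h
  change Tendsto (fun N => fejerH1 N (expH1 k)) atTop (𝓝 (expH1 k))
  simp_rw [fejerH1_expH1]
  simpa using (tendsto_fejerCoeff k).smul_const (expH1 k)

/-- The operator `f ↦ ∑ aₙ f̂(n) v(exp(inθ))`, `0 ≤ n ≤ k`. -/
noncomputable def multiplierSum (k : ℕ) (a : ℕ → ℂ) (v : H1 →L[ℂ] Y) : L1 ℂ →L[ℂ] Y :=
  ∑ n ∈ Finset.range (k + 1), a n • (coeff n).smulRight (v (expH1 n))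

lemma multiplierSum_apply (k : ℕ) (a : ℕ → ℂ) (v : H1 →L[ℂ] Y) (f : L1 ℂ) :
    multiplierSum k a v f = ∑ n ∈ Finset.range (k + 1), a n • coeff n f • v (expH1 n) := by
  simp [multiplierSum]

lemma multiplierSum_fourierLp_natCast (k : ℕ) (a : ℕ → ℂ) {v : H1 →L[ℂ] Y}
    (hv : ∀ n : ℕ, k < n → v (expH1 n) = 0) (m : ℕ) :
    multiplierSum k a v (fourierLp 1 (m : ℤ)) = a m • v (expH1 m) := by
  simp_rw [multiplierSum_apply, coeff_fourierLp, Nat.cast_inj, ite_smul, one_smul, zero_smul,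
    smul_ite, smul_zero]
  rw [Finset.sum_ite_eq]
  split_ifs with h
  · rfl
  · rw [hv m (by simpa using h), smul_zero]

lemma multiplierSum_fourierLp_eq_zero (k : ℕ) (a : ℕ → ℂ) (v : H1 →L[ℂ] Y) {m : ℤ}
    (hm : m ∉ Icc (-(k : ℤ)) k) : multiplierSum k a v (fourierLp 1 m) = 0 := by
  rw [multiplierSum_apply]
  refine Finset.sum_eq_zero fun n hn => ?_
  rw [coeff_fourierLp, if_neg, zero_smul, smul_zero]
  rw [Finset.mem_range] at hn
  rw [mem_Icc] at hm
  omega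

lemma norm_multiplierSum_le (k : ℕ) (a : ℕ → ℂ) (v : H1 →L[ℂ] Y) :
    ‖multiplierSum k a v‖ ≤ (∑ n ∈ Finset.range (k + 1), ‖a n‖) * ‖v‖ := by
  refine ContinuousLinearMap.opNorm_le_bound _ (by positivity) fun f => ?_
  rw [multiplierSum_apply, Finset.sum_mul, Finset.sum_mul]
  refine norm_sum_le_of_le _ fun n _ => ?_
  have hv : ‖v (expH1 n)‖ ≤ ‖v‖ := by
    have := v.le_opNorm (expH1 n)
    rwa [norm_expH1, mul_one] at this
  rw [norm_smul, norm_smul, mul_comm ‖coeff n f‖, ← mul_assoc]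
  gcongr
  exact norm_coeff_apply_le n f

/-- The norm is not controlled; for injectivity of `canonicalMap` the existence of an extension is
enough. -/
lemma FiniteSpectrumH1.exists_extends {v : H1 →L[ℂ] Y} (hv : FiniteSpectrumH1 v) :
    ∃ w : L1 ℂ →L[ℂ] Y, Extends w v := by
  obtain ⟨k, -, hk⟩ := hv
  refine ⟨multiplierSum k 1 v, extends_of_expH1 fun m => ?_⟩
  rw [multiplierSum_fourierLp_natCast k 1 hk, Pi.one_apply, one_smul]

lemma HasExtensions.hasFiniteExtensions {lam lam' : ℝ} (h : HasExtensions Y lam)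
    (hlt : lam < lam') : HasFiniteExtensions Y lam' := by
  rintro v ⟨k, -, hk⟩
  obtain ⟨w, hwv, hw⟩ := h v
  have hlim : Tendsto (fun M => ∑ n ∈ Finset.range (k + 1), ‖1 - fejerCoeff M n‖) atTop (𝓝 0) := by
    have := tendsto_finsetSum (Finset.range (k + 1)) fun n _ =>
      ((tendsto_const_nhds (x := (1 : ℂ))).sub (tendsto_fejerCoeff n)).norm
    simpa using this
  obtain ⟨M, hM⟩ := (hlim.eventually_le_const (sub_pos.2 hlt)).exists
  -- On `exp(imθ)`, `m ≥ 0`, the two terms contribute the factors `fejerCoeff M m` and `1 -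
  -- fejerCoeff M m`. `M` was chosen so that the correction costs at most `(lam' - lam) * ‖v‖`.
  refine ⟨w ∘L fejer M + multiplierSum k (fun n => 1 - fejerCoeff M n) v,
    ⟨max M k + 1, by omega, fun n hn => ?_⟩, extends_of_expH1 fun m => ?_, ?_⟩
  · rw [mem_Icc] at hn
    rw [add_apply, ContinuousLinearMap.comp_apply, fejer_fourierLp, fejerCoeff_eq_zero,
      multiplierSum_fourierLp_eq_zero, zero_smul, map_zero, add_zero]
    all_goals rw [mem_Icc]; omega
  · have hm : w (fourierLp 1 (m : ℤ)) = v (expH1 m) := hwv (expH1 m)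
    rw [add_apply, ContinuousLinearMap.comp_apply, fejer_fourierLp,
      multiplierSum_fourierLp_natCast k _ hk, map_smul, hm, ← add_smul, add_sub_cancel, one_smul]
  · have h1 : ‖w ∘L fejer M‖ ≤ ‖w‖ :=
      ContinuousLinearMap.opNorm_le_bound _ (norm_nonneg w) fun f =>
        (w.le_opNorm _).trans (by gcongr; exact norm_fejer_apply_le M f)
    calc _ ≤ ‖w ∘L fejer M‖ + ‖multiplierSum k (fun n => 1 - fejerCoeff M n) v‖ := norm_add_le _ _
      _ ≤ lam * ‖v‖ + (lam' - lam) * ‖v‖ := by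
        refine add_le_add (h1.trans hw) ((norm_multiplierSum_le _ _ _).trans ?_)
        gcongr
      _ = lam' * ‖v‖ := by ring

/-! ### The canonical map: injectivity, lower bounds and the constant `eta X`. -/

variable {X : Type*} [NormedAddCommGroup X] [NormedSpace ℂ X] [CompleteSpace X]

lemma tendsto_projLift_comp_fejerH1 (v : H1 →L[ℂ] StrongDual ℂ X) (u : ProjTensor H1 X) :
    Tendsto (fun N => projLift (v ∘L fejerH1 N) u) atTop (𝓝 (projLift v u)) := by
  refine pureTensor_dense
    (tendstoSubmodule (fun N => projLift (v ∘L fejerH1 N)) (projLift v))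
    (isClosed_setOf_tendsto_of_norm_le (C := ‖v‖) fun n x => ?_) (fun h x => ?_) u
  · exact (norm_projLift_apply_le _ x).trans (by gcongr; exact norm_comp_fejerH1_le v n)
  · change Tendsto (fun N => projLift (v ∘L fejerH1 N) (pureTensor h x)) atTop
      (𝓝 (projLift v (pureTensor h x)))
    simp_rw [projLift_pureTensor]
    exact (((ContinuousLinearMap.apply ℂ ℂ x).continuous.comp v.continuous).tendsto h).comp
      (tendsto_fejerH1 h)

/-- If `u` represents the zero function, every operator that extends to `L¹` annihilates it, in
particular every `v ∘ fejerH1 N`; in the limit so does the norming operator `v`. -/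
lemma injective_canonicalMap : Function.Injective (canonicalMap X) := by
  refine (injective_iff_map_eq_zero _).2 fun u hu => ?_
  obtain ⟨v, -, hv⟩ := exists_operator_norming u
  have h0 : ∀ N, projLift (v ∘L fejerH1 N) u = 0 := fun N => by
    obtain ⟨w, hw⟩ := (finiteSpectrumH1_comp_fejerH1 v N).exists_extends
    rw [← bochnerFunctional_canonicalMap hw, hu, Submodule.coe_zero, map_zero]
  have hlim := tendsto_projLift_comp_fejerH1 v u
  simp_rw [h0] at hlim
  have := tendsto_nhds_unique hlim tendsto_const_nhds
  rw [hv] at this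
  simpa using this

lemma HasFiniteExtensions.norm_le {lam : ℝ} (h : HasFiniteExtensions (StrongDual ℂ X) lam)
    (hlam : 0 ≤ lam) (u : ProjTensor H1 X) : ‖u‖ ≤ lam * ‖canonicalMap X u‖ := by
  obtain ⟨v, hv1, hv⟩ := exists_operator_norming u
  have hlim := (tendsto_projLift_comp_fejerH1 v u).norm
  rw [hv] at hlim
  have hnorm : ‖((‖u‖ : ℝ) : ℂ)‖ = ‖u‖ := by simp
  rw [hnorm] at hlim
  refine le_of_tendsto' hlim fun N => ?_
  obtain ⟨w, -, hwv, hw⟩ := h _ (finiteSpectrumH1_comp_fejerH1 v N)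
  refine (norm_projLift_apply_le_of_extends hwv u).trans ?_
  gcongr
  calc ‖w‖ ≤ lam * ‖v ∘L fejerH1 N‖ := hw
    _ ≤ lam * 1 := by gcongr; exact (norm_comp_fejerH1_le v N).trans hv1
    _ = lam := mul_one lam

lemma HasExtensions.norm_le {lam : ℝ} (h : HasExtensions (StrongDual ℂ X) lam)
    (hlam : 0 ≤ lam) (u : ProjTensor H1 X) : ‖u‖ ≤ lam * ‖canonicalMap X u‖ := by
  obtain ⟨v, hv1, hv⟩ := exists_operator_norming u
  obtain ⟨w, hwv, hw⟩ := h v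
  calc ‖u‖ = ‖projLift v u‖ := by rw [hv]; simp
    _ ≤ ‖w‖ * ‖canonicalMap X u‖ := norm_projLift_apply_le_of_extends hwv u
    _ ≤ (lam * 1) * ‖canonicalMap X u‖ := by
      gcongr
      exact hw.trans (by gcongr)
    _ = lam * ‖canonicalMap X u‖ := by rw [mul_one]

/-- A map bounded below on a complete space has closed range, and the range contains all monomials.
-/
lemma isH1Projective_of_norm_le {lam : ℝ} (hlam : 0 ≤ lam)
    (h : ∀ u : ProjTensor H1 X, ‖u‖ ≤ lam * ‖canonicalMap X u‖) : IsH1Projective X := by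
  have hanti : AntilipschitzWith ⟨lam, hlam⟩ (canonicalMap X) :=
    (canonicalMap X).antilipschitz_of_bound h
  have hclosed : IsClosed (range (canonicalMap X)) :=
    hanti.isClosed_range (canonicalMap X).uniformContinuous
  intro F
  refine mem_of_forall_monomial_mem (LinearMap.range (canonicalMap X : _ →ₗ[ℂ] Htilde X))
    (by rwa [LinearMap.coe_range]) (fun k x => ⟨pureTensor (expH1 k) x, Subtype.ext ?_⟩) F
  exact coe_canonicalMap_pureTensor (expH1 k) x

lemma eta_nonneg : 0 ≤ eta X := Real.sInf_nonneg fun _ hc => hc.1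

lemma eta_le_of_norm_le {lam : ℝ} (hlam : 0 ≤ lam)
    (h : ∀ u : ProjTensor H1 X, ‖u‖ ≤ lam * ‖canonicalMap X u‖) : eta X ≤ lam :=
  csInf_le ⟨0, fun _ hc => hc.1⟩ ⟨hlam, h⟩

/-- The inverse of the canonical map of an `H¹`-projective space. -/
noncomputable def canonicalEquiv (hX : IsH1Projective X) : ProjTensor H1 X ≃L[ℂ] Htilde X :=
  ContinuousLinearEquiv.ofBijective (canonicalMap X)
    (LinearMap.ker_eq_bot.2 injective_canonicalMap) (LinearMap.range_eq_top.2 hX)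

lemma canonicalEquiv_apply (hX : IsH1Projective X) (u : ProjTensor H1 X) :
    canonicalEquiv hX u = canonicalMap X u := rfl

lemma norm_le_eta_mul (hX : IsH1Projective X) (u : ProjTensor H1 X) :
    ‖u‖ ≤ eta X * ‖canonicalMap X u‖ := by
  rcases eq_or_ne u 0 with rfl | hu
  · simp
  have hpos : 0 < ‖canonicalMap X u‖ :=
    norm_pos_iff.2 fun h => hu (injective_canonicalMap (h.trans (map_zero _).symm))
  rw [← div_le_iff₀ hpos]
  -- By the open mapping theorem the inverse is bounded, so the infimum defining `eta X` is over a
  -- nonempty set.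
  refine le_csInf ⟨‖((canonicalEquiv hX).symm : Htilde X →L[ℂ] ProjTensor H1 X)‖,
    ContinuousLinearMap.opNorm_nonneg _, fun F => ?_⟩ fun c hc => (div_le_iff₀ hpos).2 (hc.2 u)
  simpa [← canonicalEquiv_apply hX] using
    ((canonicalEquiv hX).symm : Htilde X →L[ℂ] ProjTensor H1 X).le_opNorm (canonicalMap X F)

lemma hasExtensions_eta (hX : IsH1Projective X) :
    HasExtensions (StrongDual ℂ X) (eta X) := by
  intro v
  have hη := eta_nonneg (X := X)
  let φ : StrongDual ℂ (Htilde X) :=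
    projLift v ∘L ((canonicalEquiv hX).symm : Htilde X →L[ℂ] ProjTensor H1 X)
  have hφ : ∀ u, φ (canonicalMap X u) = projLift v u := fun u =>
    congrArg (projLift v) ((canonicalEquiv hX).symm_apply_apply u)
  have hnorm : ‖φ‖ ≤ eta X * ‖v‖ := by
    refine ContinuousLinearMap.opNorm_le_bound _ (by positivity) fun F => ?_
    obtain ⟨u, rfl⟩ := hX F
    rw [hφ, mul_comm (eta X), mul_assoc]
    refine (norm_projLift_apply_le v u).trans ?_
    gcongr
    exact norm_le_eta_mul hX u
  obtain ⟨g, hg, hgφ⟩ := exists_extension_norm_eq (Htilde X) φ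
  -- The extension sends `f` to the functional `x ↦ g(f(·)x)`.
  refine ⟨(ContinuousLinearMap.compL ℂ X (L1 X) ℂ g) ∘L (scalarTimes X).flip, fun h => ?_, ?_⟩
  · ext x
    change g (scalarTimes X x (h : L1 ℂ)) = v h x
    rw [← coe_canonicalMap_pureTensor, hg, hφ, projLift_pureTensor]
  · refine ContinuousLinearMap.opNorm_le_bound _ (by positivity) fun f =>
      ContinuousLinearMap.opNorm_le_bound _ (by positivity) fun x => ?_
    change ‖g (scalarTimes X x f)‖ ≤ _
    rw [mul_assoc]
    refine (g.le_opNorm _).trans ?_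
    gcongr
    · exact hgφ.trans_le hnorm
    · exact norm_scalarTimes_le x f

lemma HasExtensions.mono {lam lam' : ℝ} (h : HasExtensions Y lam) (hle : lam ≤ lam') :
    HasExtensions Y lam' := fun v =>
  let ⟨w, hwv, hw⟩ := h v
  ⟨w, hwv, hw.trans (by gcongr)⟩

end HardyOperators

end HOneProj

/-! ### The equivalences and the optimal constants. -/

theorem proposition2p3 (X : Type*) [NormedAddCommGroup X] [NormedSpace ℂ X] [CompleteSpace X] :
    (HOneProj.IsH1Projective X ↔
      ∃ lam : ℝ, 0 < lam ∧ HOneProj.HasExtensions (StrongDual ℂ X) lam) ∧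
    (HOneProj.IsH1Projective X ↔
      ∃ lam : ℝ, 0 < lam ∧ HOneProj.HasFiniteExtensions (StrongDual ℂ X) lam) ∧
    (HOneProj.IsH1Projective X →
      IsGLB {lam : ℝ | 0 < lam ∧ HOneProj.HasExtensions (StrongDual ℂ X) lam}
        (HOneProj.eta X) ∧
      HOneProj.HasExtensions (StrongDual ℂ X) (HOneProj.eta X) ∧
      IsGLB {lam : ℝ | 0 < lam ∧ HOneProj.HasFiniteExtensions (StrongDual ℂ X) lam}
        (HOneProj.eta X)) := by
  open HOneProj in
  have hη := eta_nonneg (X := X)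
  -- `eta X` vanishes for `X = 0`; adding 1 secures positivity, and the strict increase needed for
  -- finite spectrum.
  refine ⟨⟨fun hX => ⟨eta X + 1, by linarith, (hasExtensions_eta hX).mono (by linarith)⟩, ?_⟩,
    ⟨fun hX => ⟨eta X + 1, by linarith,
      (hasExtensions_eta hX).hasFiniteExtensions (by linarith)⟩, ?_⟩,
    fun hX => ⟨⟨?_, fun c hc => ?_⟩, hasExtensions_eta hX, ⟨?_, fun c hc => ?_⟩⟩⟩
  · rintro ⟨lam, hlam, h⟩
    exact isH1Projective_of_norm_le hlam.le (h.norm_le hlam.le)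
  · rintro ⟨lam, hlam, h⟩
    exact isH1Projective_of_norm_le hlam.le (h.norm_le hlam.le)
  · rintro lam ⟨hlam, h⟩
    exact eta_le_of_norm_le hlam.le (h.norm_le hlam.le)
  -- Every `lam > eta X` is positive and admissible, so a lower bound `c` cannot exceed `eta X`.
  · exact le_of_forall_gt_imp_ge_of_dense fun lam hlam =>
      hc ⟨hη.trans_lt hlam, (hasExtensions_eta hX).mono hlam.le⟩
  · rintro lam ⟨hlam, h⟩
    exact eta_le_of_norm_le hlam.le (h.norm_le hlam.le)
  · exact le_of_forall_gt_imp_ge_of_dense fun lam hlam =>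
      hc ⟨hη.trans_lt hlam, (hasExtensions_eta hX).hasFiniteExtensions hlam⟩
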